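/- Let $M$ be a smooth (Hausdorff) 3-dimensional manifold without boundary, with a smooth Riemannian metric $g$, Levi-Civita connection $\nabla$ and curvature tensor $R(X,Y)Z=\nabla_X\nabla_YZ-\nabla_Y\nabla_XZ-\nabla_{[X,Y]}Z$. Let $(\eta,\xi,\phi,g)$ be a contact metric structure on $M$, that is: $\eta$ is a smooth 1-form with $\eta\wedge d\eta\neq 0$ everywhere, $\xi$ is its characteristic vector field ($\eta(\xi)=1$ and $d\eta(\xi,X)=0$ for all $X$), and $\phi$ is a smooth $(1,1)$-tensor field such that $$\eta(X)=g(X,\xi),\qquad d\eta(X,Y)=g(X,\phi Y),\qquad \phi^2X=-X+\eta(X)\xi$$ for all vector fields $X,Y$, where $d\eta(X,Y)=\tfrac12\big(X\eta(Y)-Y\eta(X)-\eta([X,Y])\big)$. Suppose that (a) the structure is an $N(k)$-contact metric structure: there is a constant $k\in\mathbb R$ such that $R(X,Y)\xi=k\,[g(Y,\xi)X-g(X,\xi)Y]$ for all vector fields $X,Y$; (b) the structure is $\phi$-recurrent: there is a smooth 1-form $A$, not identically zero, such that $\phi^2((\nabla_WR)(X,Y)Z)=A(W)R(X,Y)Z$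 for all vector fields $X,Y,Z,W$. Then $(M,g)$ is flat ($R=0$). In particular it is symmetric ($\nabla R=0$) and locally $\phi$-symmetric ($\phi^2((\nabla_WR)(X,Y)Z)=0$ for all vector fields $X,Y,Z,W$ orthogonal to $\xi$). Hence there is no 3-dimensional $\phi$-recurrent $N(k)$-contact metric manifold which is neither symmetric nor locally $\phi$-symmetric. -/

import Mathlib

open scoped Manifold ContDiff

noncomputable section

namespace ContactGeom

open Bundle VectorField

section Riemannian

variable {n : ℕ} {M : Type*} [TopologicalSpace M] [ChartedSpace (EuclideanSpace ℝ (Fin n)) M]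
  [IsManifold (𝓡 n) ∞ M]

/-- Vector fields on `M`, with no regularity imposed. -/
abbrev VF (n : ℕ) (M : Type*) [TopologicalSpace M] [ChartedSpace (EuclideanSpace ℝ (Fin n)) M] :
    Type _ :=
  ∀ p : M, TangentSpace (𝓡 n) p

/-- The vector field `X` is smooth on `M`. -/
def SmoothVF (X : VF n M) : Prop :=
  ContMDiff (𝓡 n) (𝓡 n).tangent ∞ (fun p => (⟨p, X p⟩ : TangentBundle (𝓡 n) M))

/-- The vector field `X` is differentiable at the point `p`. -/
def DiffVFAt (X : VF n M) (p : M) : Prop :=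
  MDifferentiableAt (𝓡 n) (𝓡 n).tangent (fun q => (⟨q, X q⟩ : TangentBundle (𝓡 n) M)) p

/-- The derivative `X f` of the function `f` along the vector field `X`. -/
def dirDeriv (X : VF n M) (f : M → ℝ) (p : M) : ℝ :=
  mvfderiv (𝓡 n) f p (X p)

/-- The Lie bracket `[X, Y]`. -/
def bracket (X Y : VF n M) : VF n M :=
  mlieBracket (𝓡 n) X Y

/-- The smoothness of a 1-form: it takes smooth vector fields to smooth functions. -/
def SmoothOneForm (A : ∀ p : M, TangentSpace (𝓡 n) p →L[ℝ] ℝ) : Prop :=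
  ∀ X : VF n M, SmoothVF X → ContMDiff (𝓡 n) 𝓘(ℝ, ℝ) ∞ (fun p => A p (X p))

/-- The smoothness of a (1,1)-tensor field: it takes smooth vector fields to smooth vector
fields. -/
def SmoothEndo (φ : ∀ p : M, TangentSpace (𝓡 n) p →L[ℝ] TangentSpace (𝓡 n) p) : Prop :=
  ∀ X : VF n M, SmoothVF X → SmoothVF (fun p => φ p (X p))

/-- The exterior derivative of a 1-form, in the normalization
`dη(X, Y) = ½ (X η(Y) - Y η(X) - η([X, Y]))` of contact metric geometry. -/
def extD (η : ∀ p : M, TangentSpace (𝓡 n) p →L[ℝ] ℝ) (X Y : VF n M) (p : M) : ℝ :=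
  (1 / 2 : ℝ) * (dirDeriv X (fun q => η q (Y q)) p - dirDeriv Y (fun q => η q (X q)) p
    - η p (bracket X Y p))

/-- Smooth Riemannian metrics on `M`. -/
abbrev RMetric (n : ℕ) (M : Type*) [TopologicalSpace M]
    [ChartedSpace (EuclideanSpace ℝ (Fin n)) M] [IsManifold (𝓡 n) ∞ M] : Type _ :=
  ContMDiffRiemannianMetric (𝓡 n) ∞ (EuclideanSpace ℝ (Fin n))
    (fun p : M => TangentSpace (𝓡 n) p)

variable (g : RMetric n M)

/-- The right-hand side of the Koszul formula
`2 g(∇_X Y, Z) = X g(Y, Z) + Y g(Z, X) - Z g(X, Y) - g(X, [Y, Z]) - g(Y, [X, Z]) + g(Z, [X, Y])`. -/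
def koszul (X Y Z : VF n M) (p : M) : ℝ :=
  dirDeriv X (fun q => g.inner q (Y q) (Z q)) p
    + dirDeriv Y (fun q => g.inner q (Z q) (X q)) p
    - dirDeriv Z (fun q => g.inner q (X q) (Y q)) p
    - g.inner p (X p) (bracket Y Z p)
    - g.inner p (Y p) (bracket X Z p)
    + g.inner p (Z p) (bracket X Y p)

theorem diff_inner {X Y : VF n M} {p : M} (hX : DiffVFAt X p) (hY : DiffVFAt Y p) :
    MDifferentiableAt (𝓡 n) 𝓘(ℝ, ℝ) (fun q => g.inner q (X q) (Y q)) p := by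
  let _ : RiemannianBundle (fun p : M => TangentSpace (𝓡 n) p) := ⟨g.toRiemannianMetric⟩
  have : IsContMDiffRiemannianBundle (𝓡 n) 1 (EuclideanSpace ℝ (Fin n)) (fun p : M => TangentSpace (𝓡 n) p) :=
    IsContMDiffRiemannianBundle.of_le (n := ∞) (by simp)
  exact MDifferentiableAt.inner_bundle hX hY

/-- The right-hand side of the Koszul formula is a tensor in `Z`. -/
theorem koszul_tensorial (X Y : VF n M) (p : M) (hX : DiffVFAt X p) (hY : DiffVFAt Y p) :
    TensorialAt (𝓡 n) (EuclideanSpace ℝ (Fin n)) (fun Z : VF n M => koszul g X Y Z p) p where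
  smul {f Z} hf hZ := by
    have h1 := diff_inner g hY hZ
    have h2 := diff_inner g hZ hX
    have e1 : (fun q => g.inner q (Y q) ((f • Z) q)) = fun q => f q * g.inner q (Y q) (Z q) := by
      ext q; simp
    have e2 : (fun q => g.inner q ((f • Z) q) (X q)) = fun q => f q * g.inner q (Z q) (X q) := by
      ext q; simp
    simp only [koszul, dirDeriv, bracket, e1, e2, mvfderiv_fun_mul hf h1, mvfderiv_fun_mul hf h2,
      mlieBracket_smul_right hf hZ]
    simp [g.symm p (Z p)]
    ring
  add {Z Z'} hZ hZ' := by
    have e1 : (fun q => g.inner q (Y q) ((Z + Z') q)) = fun q => g.inner q (Y q) (Z q) + g.inner q (Y q) (Z' q) := by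
      ext q; simp
    have e2 : (fun q => g.inner q ((Z + Z') q) (X q)) = fun q => g.inner q (Z q) (X q) + g.inner q (Z' q) (X q) := by
      ext q; simp
    simp only [koszul, dirDeriv, bracket, e1, e2, mvfderiv_fun_add (diff_inner g hY hZ) (diff_inner g hY hZ'),
      mvfderiv_fun_add (diff_inner g hZ hX) (diff_inner g hZ' hX), mlieBracket_add_right hZ hZ']
    simp
    ring

open Classical in
/-- The Levi-Civita connection of `g`: `nabla g X Y` is `∇_X Y`, whose value at `p` is the vector
`v` (unique, and existing as soon as `X` and `Y` are differentiable at `p`) determined by the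
Koszul formula. -/
def nabla (X Y : VF n M) : VF n M := fun p =>
  if h : ∃ v : TangentSpace (𝓡 n) p, ∀ Z : VF n M, DiffVFAt Z p →
      2 * g.inner p v (Z p) = koszul g X Y Z p
  then h.choose else 0

/-- The Levi-Civita connection satisfies the Koszul formula. -/
theorem nabla_spec (X Y : VF n M) (p : M) (hX : DiffVFAt X p) (hY : DiffVFAt Y p) :
    ∀ Z : VF n M, DiffVFAt Z p → 2 * g.inner p (nabla g X Y p) (Z p) = koszul g X Y Z p := by
  have h : ∃ v : TangentSpace (𝓡 n) p, ∀ Z : VF n M, DiffVFAt Z p →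
      2 * g.inner p v (Z p) = koszul g X Y Z p := by
    let L := TensorialAt.mkHom _ p (koszul_tensorial g X Y p hX hY)
    let B : EuclideanSpace ℝ (Fin n) →ₗ[ℝ] (EuclideanSpace ℝ (Fin n) →L[ℝ] ℝ) := (g.inner p).toLinearMap
    let C : EuclideanSpace ℝ (Fin n) →ₗ[ℝ] Module.Dual ℝ (EuclideanSpace ℝ (Fin n)) :=
      (ContinuousLinearMap.coeLM ℝ).comp B
    have hC : Function.Injective C := by
      rw [injective_iff_map_eq_zero]
      intro v hv
      by_contra hne
      have := g.pos p v hne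
      have h2 : C v v = 0 := by rw [hv]; rfl
      exact absurd h2 this.ne'
    have hs : Function.Surjective C :=
      (LinearMap.injective_iff_surjective_of_finrank_eq_finrank (Subspace.dual_finrank_eq).symm).1 hC
    obtain ⟨v, hv⟩ := hs ((1/2:ℝ) • (L : EuclideanSpace ℝ (Fin n) →L[ℝ] ℝ).toLinearMap)
    refine ⟨v, fun Z hZ => ?_⟩
    have e : g.inner p v (Z p) = (1/2:ℝ) * L (Z p) := DFunLike.congr_fun hv (Z p)
    rw [e, TensorialAt.mkHom_apply _ hZ]; ring
  unfold nabla
  rw [dif_pos h]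
  exact h.choose_spec

/-- The curvature `R(X, Y)Z = ∇_X ∇_Y Z - ∇_Y ∇_X Z - ∇_[X, Y] Z`. -/
def curv (X Y Z : VF n M) : VF n M :=
  nabla g X (nabla g Y Z) - nabla g Y (nabla g X Z) - nabla g (bracket X Y) Z

/-- The covariant derivative of the curvature tensor,
`(∇_W R)(X, Y)Z = ∇_W (R(X, Y)Z) - R(∇_W X, Y)Z - R(X, ∇_W Y)Z - R(X, Y)∇_W Z`. -/
def nablaCurv (W X Y Z : VF n M) : VF n M :=
  nabla g W (curv g X Y Z) - curv g (nabla g W X) Y Z - curv g X (nabla g W Y) Z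
    - curv g X Y (nabla g W Z)

/-- `(M, g)` is flat: `R = 0`. -/
def IsFlat : Prop :=
  ∀ X Y Z : VF n M, SmoothVF X → SmoothVF Y → SmoothVF Z → ∀ p, curv g X Y Z p = 0

/-- `(M, g)` is (locally) symmetric: `∇R = 0`. -/
def IsSymmetricMetric : Prop :=
  ∀ W X Y Z : VF n M, SmoothVF W → SmoothVF X → SmoothVF Y → SmoothVF Z →
    ∀ p, nablaCurv g W X Y Z p = 0

/-- The `k`-nullity distribution: `N_p(k)` is the set of those `z` in `T_p M` with
`R(X, Y)z = k (g(Y, z)X - g(X, z)Y)` for all `X`, `Y`. As `R` is a tensor, its value on `z` is its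
value on any smooth field `Z` through `z`. -/
def nullity (k : ℝ) (p : M) : Set (TangentSpace (𝓡 n) p) :=
  {z | ∀ X Y Z : VF n M, SmoothVF X → SmoothVF Y → SmoothVF Z → Z p = z →
    curv g X Y Z p = k • (g.inner p (Y p) z • X p - g.inner p (X p) z • Y p)}

end Riemannian

section Contact

variable {M : Type*} [TopologicalSpace M] [ChartedSpace (EuclideanSpace ℝ (Fin 3)) M]
  [IsManifold (𝓡 3) ∞ M]

/-- A contact metric structure `(η, ξ, φ, g)` on a 3-dimensional Riemannian manifold `(M, g)`. -/
structure ContactMetric (g : RMetric 3 M) where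
  /-- the contact form -/
  η : ∀ p : M, TangentSpace (𝓡 3) p →L[ℝ] ℝ
  /-- the characteristic vector field -/
  ξ : VF 3 M
  /-- the structure tensor -/
  φ : ∀ p : M, TangentSpace (𝓡 3) p →L[ℝ] TangentSpace (𝓡 3) p
  smooth_η : SmoothOneForm η
  smooth_ξ : SmoothVF ξ
  smooth_φ : SmoothEndo φ
  /-- `η ∧ dη` vanishes nowhere. -/
  contact : ∀ p : M, ∃ X Y Z : VF 3 M, SmoothVF X ∧ SmoothVF Y ∧ SmoothVF Z ∧
    η p (X p) * extD η Y Z p + η p (Y p) * extD η Z X p + η p (Z p) * extD η X Y p ≠ 0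
  η_ξ : ∀ p : M, η p (ξ p) = 1
  extD_ξ : ∀ X : VF 3 M, SmoothVF X → ∀ p, extD η ξ X p = 0
  η_eq : ∀ (p : M) (v : TangentSpace (𝓡 3) p), η p v = g.inner p v (ξ p)
  extD_eq : ∀ X Y : VF 3 M, SmoothVF X → SmoothVF Y →
    ∀ p, extD η X Y p = g.inner p (X p) (φ p (Y p))
  φ_sq : ∀ (p : M) (v : TangentSpace (𝓡 3) p), φ p (φ p v) = -v + η p v • ξ p

namespace ContactMetric

variable {g : RMetric 3 M} (S : ContactMetric g)

/-- The structure is an `N(k)`-contact metric structure: `ξ` belongs to the `k`-nullity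
distribution. -/
def IsNk (k : ℝ) : Prop :=
  ∀ p, S.ξ p ∈ nullity g k p

/-- The structure is `φ`-recurrent: `φ²((∇_W R)(X, Y)Z) = A(W) R(X, Y)Z` for a 1-form `A` that is
not identically zero. -/
def IsPhiRecurrent : Prop :=
  ∃ A : ∀ p : M, TangentSpace (𝓡 3) p →L[ℝ] ℝ, SmoothOneForm A ∧ (∃ p, A p ≠ 0) ∧
    ∀ W X Y Z : VF 3 M, SmoothVF W → SmoothVF X → SmoothVF Y → SmoothVF Z →
      ∀ p, S.φ p (S.φ p (nablaCurv g W X Y Z p)) = A p (W p) • curv g X Y Z p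

/-- The structure is locally `φ`-symmetric: `φ²((∇_W R)(X, Y)Z) = 0` for all `X`, `Y`, `Z`, `W`
orthogonal to `ξ`. -/
def IsLocallyPhiSymmetric : Prop :=
  ∀ W X Y Z : VF 3 M, SmoothVF W → SmoothVF X → SmoothVF Y → SmoothVF Z →
    (∀ p, g.inner p (W p) (S.ξ p) = 0) → (∀ p, g.inner p (X p) (S.ξ p) = 0) →
    (∀ p, g.inner p (Y p) (S.ξ p) = 0) → (∀ p, g.inner p (Z p) (S.ξ p) = 0) →
      ∀ p, S.φ p (S.φ p (nablaCurv g W X Y Z p)) = 0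

end ContactMetric

end Contact

end ContactGeom

end

noncomputable section

namespace ContactGeom

open Bundle VectorField Filter Topology

/-! ### Smooth vector fields, directional derivatives and brackets -/

section Riemannian

variable {n : ℕ} {M : Type*} [TopologicalSpace M] [ChartedSpace (EuclideanSpace ℝ (Fin n)) M]

/-! The values of `φ²` are orthogonal to `ξ`, so pairing the recurrence identity with `ξ` at a point
where `A ≠ 0` forces `k = 0` (`nullity_const_eq_zero`), that is, `R(X, Y)ξ = 0`.

Put `T = ∇ξ` (`shape`). Then `R(X, Y)ξ = 0` is the Codazzi equation for `T`, and since `Tξ = 0` it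
contains the Riccati equation `∇_ξ T = -T²`. The skew part of `T` is `-φ`, whose matrix in a frame
`e, φe` of `ξ^⊥` is constant, so the skew part of the Riccati equation gives `tr T = 0` and its
trace then gives `tr T² = 0` (`frame_riccati`). Hence `T² = 0` (`shape_shape`), while `T ≠ 0`. This
yields a local frame with `Te = -2φe`, `T(φe) = 0` (`exists_adapted_frame`), and Codazzi makes `e`
parallel (`nabla_adapted_eq_zero`). The skew endomorphism `R(X, Y)` of a 3-dimensional space kills
`ξ` and `e`, so it is zero (`isFlat_of_curv_ξ`). -/

theorem dirDeriv_congr {X : VF n M} {f f' : M → ℝ} {p : M} (h : f =ᶠ[𝓝 p] f') :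
    dirDeriv X f p = dirDeriv X f' p := by
  simp only [dirDeriv, mvfderiv, ContinuousLinearMap.comp_apply]
  rw [h.mfderiv_eq, h.self_of_nhds]

theorem dirDeriv_of_eventually_const {X : VF n M} {f : M → ℝ} {p : M} {c : ℝ}
    (h : ∀ᶠ q in 𝓝 p, f q = c) : dirDeriv X f p = 0 := by
  rw [dirDeriv_congr (f' := fun _ => c) h]
  simp only [dirDeriv]
  rw [mvfderiv_const]
  rfl

theorem extD_swap (η : ∀ p : M, TangentSpace (𝓡 n) p →L[ℝ] ℝ) (X Y : VF n M) (p : M) :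
    extD η X Y p = - extD η Y X p := by
  have sw : bracket X Y p = - bracket Y X p := mlieBracket_swap_apply
  simp only [extD, sw, map_neg]
  ring

variable [IsManifold (𝓡 n) ∞ M]

theorem SmoothVF.diffVFAt {X : VF n M} (hX : SmoothVF X) (p : M) : DiffVFAt X p :=
  (hX p).mdifferentiableAt (by simp)

theorem SmoothVF.neg {X : VF n M} (hX : SmoothVF X) : SmoothVF (-X) :=
  ContMDiff.neg_section hX

theorem SmoothVF.smul {f : M → ℝ} {X : VF n M} (hf : ContMDiff (𝓡 n) 𝓘(ℝ, ℝ) ∞ f)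
    (hX : SmoothVF X) : SmoothVF (f • X) :=
  ContMDiff.smul_section hf hX

theorem SmoothVF.zero : SmoothVF (0 : VF n M) :=
  contMDiff_zeroSection ℝ (fun p : M => TangentSpace (𝓡 n) p)

theorem SmoothVF.bracket {X Y : VF n M} (hX : SmoothVF X) (hY : SmoothVF Y) :
    SmoothVF (bracket X Y) :=
  have : IsManifold (𝓡 n) (((⊤ : ℕ∞) : WithTop ℕ∞) + 1) M := ‹IsManifold (𝓡 n) ∞ M›
  have : IsManifold (𝓡 n) (minSmoothness ℝ 2) M :=
    IsManifold.of_le (n := ∞) (by simpa using ENat.LEInfty.out)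
  ContDiff.mlieBracket_vectorField (m := ⊤) (n := ⊤) hX hY (by simp)

theorem smooth_dirDeriv {X : VF n M} {f : M → ℝ} (hX : SmoothVF X)
    (hf : ContMDiff (𝓡 n) 𝓘(ℝ, ℝ) ∞ f) : ContMDiff (𝓡 n) 𝓘(ℝ, ℝ) ∞ (dirDeriv X f) := by
  have h := (hf.contMDiff_tangentMap (m := ∞) (by simp)).comp hX
  exact (contMDiff_snd_tangentBundle_modelSpace (I := 𝓘(ℝ, ℝ)) (n := ∞)).comp h

/-- On a Hausdorff manifold every tangent vector is the value of a smooth vector field. -/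
theorem exists_smoothVF [T2Space M] (p : M) (v : TangentSpace (𝓡 n) p) :
    ∃ X : VF n M, SmoothVF X ∧ X p = v := by
  obtain ⟨s, hs, hsm⟩ := FiberBundle.exists_contMDiffOn_extend (k := ∞) (𝓡 n)
    (EuclideanSpace ℝ (Fin n)) (V := fun q : M => TangentSpace (𝓡 n) q) v
  obtain ⟨u, hus, huo, hpu⟩ := mem_nhds_iff.1 hs
  -- The local extension of `v` is cut off by a bump function; Hausdorffness makes the extension by
  -- zero smooth.
  obtain ⟨ψ, -, hψ⟩ := (SmoothBumpFunction.nhds_basis_tsupport (I := 𝓡 n) p).mem_iff.1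
    (huo.mem_nhds hpu)
  refine ⟨fun q => ψ q • FiberBundle.extend (EuclideanSpace ℝ (Fin n)) v q,
    ContMDiffOn.smul_section_of_tsupport ψ.contMDiff.contMDiffOn huo hψ (hsm.mono hus), ?_⟩
  simp

theorem exists_diffVFAt (p : M) (v : TangentSpace (𝓡 n) p) :
    ∃ X : VF n M, DiffVFAt X p ∧ X p = v :=
  ⟨FiberBundle.extend (EuclideanSpace ℝ (Fin n)) v,
    FiberBundle.mdifferentiableAt_extend (𝓡 n) (EuclideanSpace ℝ (Fin n)) v, by simp⟩

/-- The Lie bracket of vector fields acts on functions as the commutator. -/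
theorem dirDeriv_bracket [T2Space M] {X Y : VF n M} {f : M → ℝ} (hX : SmoothVF X)
    (hY : SmoothVF Y) (hf : ContMDiff (𝓡 n) 𝓘(ℝ, ℝ) ∞ f) (p : M) :
    dirDeriv (bracket X Y) f p = dirDeriv X (dirDeriv Y f) p - dirDeriv Y (dirDeriv X f) p := by
  -- The Jacobi identity for `X, Y, f • Z`, expanded by the Leibniz rule, leaves the desired
  -- identity multiplied by `Z p`, so a `Z` with `Z p ≠ 0` is needed. If the tangent space is
  -- trivial, both sides vanish.
  by_cases hv : ∃ v : TangentSpace (𝓡 n) p, v ≠ 0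
  · obtain ⟨v, hv⟩ := hv
    obtain ⟨Z, hZ, rfl⟩ := exists_smoothVF p v
    have md : ∀ {h : M → ℝ}, ContMDiff (𝓡 n) 𝓘(ℝ, ℝ) ∞ h → ∀ q,
        MDifferentiableAt (𝓡 n) 𝓘(ℝ, ℝ) h q := fun h q => (h q).mdifferentiableAt (by simp)
    have key : ∀ {V : VF n M} {h : M → ℝ} {W : VF n M}, ContMDiff (𝓡 n) 𝓘(ℝ, ℝ) ∞ h →
        SmoothVF W → bracket V (h • W) = dirDeriv V h • W + h • bracket V W := by
      intro V h W hh hW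
      funext q
      exact mlieBracket_smul_right (md hh q) (hW.diffVFAt q)
    have key' : ∀ {V W W' : VF n M}, SmoothVF W → SmoothVF W' →
        bracket V (W + W') = bracket V W + bracket V W' := by
      intro V W W' hW hW'
      funext q
      exact mlieBracket_add_right (hW.diffVFAt q) (hW'.diffVFAt q)
    have jac : ∀ {W : VF n M}, SmoothVF W → bracket X (bracket Y W) =
        bracket (bracket X Y) W + bracket Y (bracket X W) := by
      intro W hW
      have : IsManifold (𝓡 n) (minSmoothness ℝ 3) M :=
        IsManifold.of_le (n := ∞) (by simpa using ENat.LEInfty.out)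
      have le : minSmoothness ℝ 2 ≤ (∞ : WithTop ℕ∞) := by simpa using ENat.LEInfty.out
      exact leibniz_identity_mlieBracket (hX.of_le le) (hY.of_le le) (hW.of_le le)
    have hXf := smooth_dirDeriv hX hf
    have hYf := smooth_dirDeriv hY hf
    have e := congrFun (jac (hZ.smul hf)) p
    have e' := congrFun (jac hZ) p
    rw [key hf hZ, key hf hZ, key hf hZ, key' (hZ.smul hYf) ((hY.bracket hZ).smul hf),
      key' (hZ.smul hXf) ((hX.bracket hZ).smul hf), key hYf hZ, key hXf hZ,
      key hf (hY.bracket hZ), key hf (hX.bracket hZ)] at e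
    simp only [Pi.add_apply, Pi.smul_apply'] at e e'
    rw [e'] at e
    have : (dirDeriv (bracket X Y) f p - (dirDeriv X (dirDeriv Y f) p
        - dirDeriv Y (dirDeriv X f) p)) • Z p = 0 := by
      simp only [smul_add, sub_smul] at e ⊢
      rw [← sub_eq_zero] at e
      rw [← neg_eq_zero, ← e]
      abel
    rcases smul_eq_zero.1 this with h | h
    · linarith
    · exact absurd h hv
  · push Not at hv
    simp [dirDeriv, hv (X p), hv (Y p), hv (bracket X Y p)]

/-! ### The Levi-Civita connection and the skew-symmetry of its curvature -/

variable (g : RMetric n M)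

theorem smooth_inner {X Y : VF n M} (hX : SmoothVF X) (hY : SmoothVF Y) :
    ContMDiff (𝓡 n) 𝓘(ℝ, ℝ) ∞ (fun q => g.inner q (X q) (Y q)) := by
  let _ : RiemannianBundle (fun p : M => TangentSpace (𝓡 n) p) := ⟨g.toRiemannianMetric⟩
  exact ContMDiff.inner_bundle hX hY

theorem smooth_koszul {X Y Z : VF n M} (hX : SmoothVF X) (hY : SmoothVF Y) (hZ : SmoothVF Z) :
    ContMDiff (𝓡 n) 𝓘(ℝ, ℝ) ∞ (koszul g X Y Z) :=
  (((((smooth_dirDeriv hX (smooth_inner g hY hZ)).add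
    (smooth_dirDeriv hY (smooth_inner g hZ hX))).sub
    (smooth_dirDeriv hZ (smooth_inner g hX hY))).sub
    (smooth_inner g hX (hY.bracket hZ))).sub
    (smooth_inner g hY (hX.bracket hZ))).add
    (smooth_inner g hZ (hX.bracket hY))

variable {g}

theorem eq_of_inner_eq {p : M} {v w : TangentSpace (𝓡 n) p}
    (h : ∀ u, g.inner p v u = g.inner p w u) : v = w := by
  by_contra hne
  have := g.pos p (v - w) (sub_ne_zero.2 hne)
  simp [h] at this

theorem nabla_metric {X Y Z : VF n M} {p : M} (hX : DiffVFAt X p) (hY : DiffVFAt Y p)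
    (hZ : DiffVFAt Z p) :
    dirDeriv X (fun q => g.inner q (Y q) (Z q)) p =
      g.inner p (nabla g X Y p) (Z p) + g.inner p (Y p) (nabla g X Z p) := by
  have h1 := nabla_spec g X Y p hX hY Z hZ
  have h2 := nabla_spec g X Z p hX hZ Y hY
  rw [g.symm p (nabla g X Z p)] at h2
  have s : ∀ A B : VF n M, (fun q => g.inner q (A q) (B q)) = fun q => g.inner q (B q) (A q) :=
    fun A B => funext fun q => g.symm q _ _
  have sw : bracket Y Z p = - bracket Z Y p := mlieBracket_swap_apply
  simp only [koszul, sw, s X Y, s Z X, s Z Y, map_neg] at h1 h2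
  linarith

theorem nabla_torsion {X Y : VF n M} {p : M} (hX : DiffVFAt X p) (hY : DiffVFAt Y p) :
    nabla g X Y p - nabla g Y X p = bracket X Y p := by
  refine eq_of_inner_eq (g := g) fun u => ?_
  obtain ⟨Z, hZ, rfl⟩ := exists_diffVFAt p u
  have h1 := nabla_spec g X Y p hX hY Z hZ
  have h2 := nabla_spec g Y X p hY hX Z hZ
  have s : ∀ A B : VF n M, (fun q => g.inner q (A q) (B q)) = fun q => g.inner q (B q) (A q) :=
    fun A B => funext fun q => g.symm q _ _
  have sw : bracket Y X p = - bracket X Y p := mlieBracket_swap_apply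
  simp only [koszul, sw, s Y X, s Z X, s Z Y, map_neg] at h1 h2
  rw [map_sub, sub_apply, g.symm p (bracket X Y p)]
  linarith

/-- In the Koszul formula for `f • X` the terms containing derivatives of `f` cancel. This is what
makes `∇ξ` an endomorphism of each tangent space. -/
theorem nabla_tensorial {Y : VF n M} {p : M} (hY : DiffVFAt Y p) :
    TensorialAt (𝓡 n) (EuclideanSpace ℝ (Fin n)) (fun X : VF n M => nabla g X Y p) p where
  smul {f X} hf hX := by
    have hfX : DiffVFAt (f • X) p := MDifferentiableAt.smul_section hf hX
    refine eq_of_inner_eq (g := g) fun u => ?_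
    obtain ⟨Z, hZ, rfl⟩ := exists_diffVFAt p u
    have h1 := nabla_spec g X Y p hX hY Z hZ
    have h2 := nabla_spec g (f • X) Y p hfX hY Z hZ
    have e1 : (fun q => g.inner q (Z q) ((f • X) q)) = fun q => f q * g.inner q (Z q) (X q) := by
      ext q; simp
    have e2 : (fun q => g.inner q ((f • X) q) (Y q)) = fun q => f q * g.inner q (X q) (Y q) := by
      ext q; simp
    simp only [koszul, dirDeriv, bracket, e1, e2, mvfderiv_fun_mul hf (diff_inner g hZ hX),
      mvfderiv_fun_mul hf (diff_inner g hX hY), mlieBracket_smul_left hf hX] at h1 h2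
    simp [g.symm p (Y p) (X p)] at h1 h2 ⊢
    linear_combination (1 / 2 : ℝ) * h2 - (1 / 2 : ℝ) * f p * h1
  add {X X'} hX hX' := by
    have hXX : DiffVFAt (X + X') p := mdifferentiableAt_add_section hX hX'
    refine eq_of_inner_eq (g := g) fun u => ?_
    obtain ⟨Z, hZ, rfl⟩ := exists_diffVFAt p u
    have h1 := nabla_spec g X Y p hX hY Z hZ
    have h2 := nabla_spec g X' Y p hX' hY Z hZ
    have h3 := nabla_spec g (X + X') Y p hXX hY Z hZ
    have e1 : (fun q => g.inner q (Z q) ((X + X') q)) =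
        fun q => g.inner q (Z q) (X q) + g.inner q (Z q) (X' q) := by
      ext q; simp
    have e2 : (fun q => g.inner q ((X + X') q) (Y q)) =
        fun q => g.inner q (X q) (Y q) + g.inner q (X' q) (Y q) := by
      ext q; simp
    simp only [koszul, dirDeriv, bracket, e1, e2,
      mvfderiv_fun_add (diff_inner g hZ hX) (diff_inner g hZ hX'),
      mvfderiv_fun_add (diff_inner g hX hY) (diff_inner g hX' hY),
      mlieBracket_add_left hX hX'] at h1 h2 h3
    simp at h1 h2 h3 ⊢
    linear_combination (1 / 2 : ℝ) * h3 - (1 / 2 : ℝ) * h1 - (1 / 2 : ℝ) * h2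

/-- `∇_X Y` at `p` depends linearly on the value of `X` at `p`. -/
theorem exists_nabla_eq_linear (g : RMetric n M) {Y : VF n M} {p : M} (hY : DiffVFAt Y p) :
    ∃ L : TangentSpace (𝓡 n) p →L[ℝ] TangentSpace (𝓡 n) p,
      ∀ X : VF n M, DiffVFAt X p → nabla g X Y p = L (X p) :=
  ⟨TensorialAt.mkHom _ p (nabla_tensorial (g := g) hY),
    fun _ hX => (TensorialAt.mkHom_apply (nabla_tensorial (g := g) hY) hX).symm⟩

/-- Differentiating `g(Y, Z) = 0` near `p` leaves only the term `g(∇_X Y, Z)`. -/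
theorem nabla_of_eventually_eq_zero {X Y : VF n M} {p : M} (hX : DiffVFAt X p)
    (hY : DiffVFAt Y p) (h : ∀ᶠ q in 𝓝 p, Y q = 0) : nabla g X Y p = 0 := by
  refine eq_of_inner_eq (g := g) fun u => ?_
  obtain ⟨Z, hZ, rfl⟩ := exists_diffVFAt p u
  have h1 := nabla_metric (g := g) hX hY hZ
  rw [dirDeriv_of_eventually_const (c := 0) (h.mono fun q hq => by simp [hq]),
    h.self_of_nhds] at h1
  simpa using h1.symm

/-- The connection maps smooth fields to smooth fields if there are orthonormal frames of smooth
fields near each point. -/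
theorem smooth_nabla_of_frame {ι : Type*} [Fintype ι]
    (hE : ∀ p : M, ∃ E : ι → VF n M, (∀ i, SmoothVF (E i)) ∧
      ∀ᶠ q in 𝓝 p, ∀ v : TangentSpace (𝓡 n) q, v = ∑ i, g.inner q v (E i q) • E i q)
    {X Y : VF n M} (hX : SmoothVF X) (hY : SmoothVF Y) : SmoothVF (nabla g X Y) := by
  intro p
  obtain ⟨E, hEs, hE⟩ := hE p
  -- `nabla` is chosen point by point; in an orthonormal frame its coefficients are half the Koszul
  -- expressions, which are smooth.
  have h : SmoothVF (fun q => ∑ i, ((1 / 2 : ℝ) * koszul g X Y (E i) q) • E i q) :=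
    ContMDiff.sum_section fun i _ =>
      (hEs i).smul (contMDiff_const.mul (smooth_koszul g hX hY (hEs i)))
  refine (h p).congr_of_eventuallyEq (hE.mono fun q hq => ?_)
  change (⟨q, _⟩ : TangentBundle (𝓡 n) M) = ⟨q, _⟩
  congr 1
  refine (hq _).trans (Finset.sum_congr rfl fun i _ => ?_)
  rw [← nabla_spec g X Y q (hX.diffVFAt q) (hY.diffVFAt q) (E i) ((hEs i).diffVFAt q)]
  congr 1
  ring

/-- `R(X, Y)` is skew-symmetric. -/
theorem inner_curv_skew [T2Space M]
    (hN : ∀ X Y : VF n M, SmoothVF X → SmoothVF Y → SmoothVF (nabla g X Y))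
    {X Y Z W : VF n M} (hX : SmoothVF X) (hY : SmoothVF Y) (hZ : SmoothVF Z) (hW : SmoothVF W)
    (p : M) : g.inner p (curv g X Y Z p) (W p) = - g.inner p (curv g X Y W p) (Z p) := by
  have m : ∀ {A B C : VF n M}, SmoothVF A → SmoothVF B → SmoothVF C → ∀ q,
      dirDeriv A (fun q => g.inner q (B q) (C q)) q =
      g.inner q (nabla g A B q) (C q) + g.inner q (B q) (nabla g A C q) :=
    fun hA hB hC q => nabla_metric (hA.diffVFAt q) (hB.diffVFAt q) (hC.diffVFAt q)
  have md : ∀ {A B : VF n M}, SmoothVF A → SmoothVF B →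
      MDifferentiableAt (𝓡 n) 𝓘(ℝ, ℝ) (fun q => g.inner q (A q) (B q)) p :=
    fun hA hB => (smooth_inner g hA hB p).mdifferentiableAt (by simp)
  -- The mixed terms are symmetric in `A` and `B`, so they drop out when `XY - YX - [X, Y] = 0` is
  -- applied to `g(Z, W)`.
  have second : ∀ {A B : VF n M}, SmoothVF A → SmoothVF B →
      dirDeriv A (dirDeriv B (fun q => g.inner q (Z q) (W q))) p =
      g.inner p (nabla g A (nabla g B Z) p) (W p) + g.inner p (nabla g B Z p) (nabla g A W p)
      + (g.inner p (nabla g A Z p) (nabla g B W p)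
        + g.inner p (Z p) (nabla g A (nabla g B W) p)) := by
    intro A B hA hB
    rw [show dirDeriv B (fun q => g.inner q (Z q) (W q)) = fun q =>
      g.inner q (nabla g B Z q) (W q) + g.inner q (Z q) (nabla g B W q) from
      funext fun q => m hB hZ hW q, ← m hA (hN B Z hB hZ) hW, ← m hA hZ (hN B W hB hW)]
    simp only [dirDeriv]
    rw [mvfderiv_fun_add (md (hN B Z hB hZ) hW) (md hZ (hN B W hB hW))]
    rfl
  have e := dirDeriv_bracket hX hY (smooth_inner g hZ hW) p
  rw [second hX hY, second hY hX, m (hX.bracket hY) hZ hW] at e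
  simp only [curv, Pi.sub_apply, map_sub, sub_apply]
  rw [g.symm p _ (Z p), g.symm p _ (Z p), g.symm p _ (Z p)]
  linarith

end Riemannian

/-! ### Algebra of contact metric structures and adapted orthonormal frames -/

section Contact

variable {M : Type*} [TopologicalSpace M] [ChartedSpace (EuclideanSpace ℝ (Fin 3)) M]
  [IsManifold (𝓡 3) ∞ M]

/-- Near a positive number, the function `1 / √t` coincides with a smooth function on `ℝ`. -/
theorem exists_contDiff_sq_mul_eq_one {r : ℝ} (hr : 0 < r) :
    ∃ ψ : ℝ → ℝ, ContDiff ℝ ∞ ψ ∧ ∀ᶠ t in 𝓝 r, ψ t * ψ t * t = 1 := by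
  -- The cutoff is 0 for `t ≤ r/4` and 1 for `t ≥ 3r/4`, which removes the singularity at 0 and
  -- keeps normalized fields globally smooth.
  refine ⟨fun t => Real.smoothTransition (2 * t / r - 1 / 2) / √t, ?_, ?_⟩
  · rw [contDiff_iff_contDiffAt]
    intro t
    rcases lt_or_ge 0 t with ht | ht
    · refine ContDiffAt.div ?_ (Real.contDiffAt_sqrt ht.ne') (Real.sqrt_pos.2 ht).ne'
      exact (Real.smoothTransition.contDiff.comp (by fun_prop)).contDiffAt
    · refine (contDiffAt_const (c := (0 : ℝ))).congr_of_eventuallyEq ?_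
      have : ∀ᶠ s in 𝓝 t, s < r / 4 := gt_mem_nhds (by linarith)
      filter_upwards [this] with s hs
      rw [Real.smoothTransition.zero_of_nonpos, zero_div]
      have : 2 * s / r ≤ 1 / 2 := by rw [div_le_iff₀ hr]; linarith
      linarith
  · have : ∀ᶠ s in 𝓝 r, 3 / 4 * r < s := lt_mem_nhds (by linarith)
    filter_upwards [this] with s hs
    have hs0 : 0 < s := by linarith
    have : 3 / 2 ≤ 2 * s / r := by rw [le_div_iff₀ hr]; linarith
    rw [Real.smoothTransition.one_of_one_le (by linarith)]
    field_simp
    rw [Real.sq_sqrt hs0.le]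

namespace ContactMetric

variable {g : RMetric 3 M} (S : ContactMetric g)

theorem inner_ξ_ξ (p : M) : g.inner p (S.ξ p) (S.ξ p) = 1 := by
  rw [← S.η_eq, S.η_ξ]

theorem inner_φ_skew [T2Space M] (p : M) (v w : TangentSpace (𝓡 3) p) :
    g.inner p v (S.φ p w) = - g.inner p w (S.φ p v) := by
  obtain ⟨X, hX, rfl⟩ := exists_smoothVF p v
  obtain ⟨Y, hY, rfl⟩ := exists_smoothVF p w
  rw [← S.extD_eq X Y hX hY, ← S.extD_eq Y X hY hX, extD_swap]

theorem inner_ξ_φ [T2Space M] (p : M) (v : TangentSpace (𝓡 3) p) :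
    g.inner p (S.ξ p) (S.φ p v) = 0 := by
  obtain ⟨X, hX, rfl⟩ := exists_smoothVF p v
  rw [← S.extD_eq _ X S.smooth_ξ hX, S.extD_ξ X hX]

/-- Compatibility of `φ` with `g` is not an axiom: it follows from the skewness of `φ` and the
formula for `φ²`. -/
theorem inner_φ_φ [T2Space M] (p : M) (v w : TangentSpace (𝓡 3) p) :
    g.inner p (S.φ p v) (S.φ p w) =
      g.inner p v w - g.inner p v (S.ξ p) * g.inner p w (S.ξ p) := by
  rw [S.inner_φ_skew, S.φ_sq, map_add, map_smul, S.η_eq, map_neg, g.symm p w v, smul_eq_mul]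
  ring

theorem inner_self_φ [T2Space M] (p : M) (v : TangentSpace (𝓡 3) p) :
    g.inner p v (S.φ p v) = 0 := by
  linarith [S.inner_φ_skew p v v]

/-- A unit vector `v` orthogonal to `ξ` gives the orthonormal basis `ξ, v, φ v`. -/
theorem eq_frame_sum [T2Space M] {p : M} {e : TangentSpace (𝓡 3) p} (he : g.inner p e e = 1)
    (heξ : g.inner p e (S.ξ p) = 0) (v : TangentSpace (𝓡 3) p) :
    v = g.inner p v (S.ξ p) • S.ξ p + g.inner p v e • e
      + g.inner p v (S.φ p e) • S.φ p e := by
  have hff : g.inner p (S.φ p e) (S.φ p e) = 1 := by rw [S.inner_φ_φ, he, heξ]; ring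
  have hef := S.inner_self_φ p e
  have hfe : g.inner p (S.φ p e) e = 0 := by rw [g.symm]; exact hef
  have hξf := S.inner_ξ_φ p e
  have hfξ : g.inner p (S.φ p e) (S.ξ p) = 0 := by rw [g.symm]; exact hξf
  have hξe : g.inner p (S.ξ p) e = 0 := by rw [g.symm]; exact heξ
  have hξξ := S.inner_ξ_ξ p
  let b : Fin 3 → EuclideanSpace ℝ (Fin 3) := ![S.ξ p, e, S.φ p e]
  have hb : LinearIndependent ℝ b := by
    rw [Fintype.linearIndependent_iff]
    intro c hc
    have hc' : c 0 • S.ξ p + c 1 • e + c 2 • S.φ p e = 0 :=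
      (Fin.sum_univ_three (fun i => c i • b i)).symm.trans hc
    have h0 := congrArg (fun u => g.inner p u (S.ξ p)) hc'
    have h1 := congrArg (fun u => g.inner p u e) hc'
    have h2 := congrArg (fun u => g.inner p u (S.φ p e)) hc'
    simp [hff, hef, hfe, hξf, hfξ, hξe, hξξ, he, heξ] at h0 h1 h2
    intro i
    fin_cases i <;> assumption
  have hspan := hb.span_eq_top_of_card_eq_finrank (by simp)
  have hv : ∀ w : EuclideanSpace ℝ (Fin 3), ∃ c : Fin 3 → ℝ, ∑ i, c i • b i = w := fun w =>
    (Submodule.mem_span_range_iff_exists_fun ℝ).1 (hspan ▸ Submodule.mem_top)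
  obtain ⟨c, hc⟩ := hv v
  have hc' : c 0 • S.ξ p + c 1 • e + c 2 • S.φ p e = v :=
    (Fin.sum_univ_three (fun i => c i • b i)).symm.trans hc
  rw [← hc']
  simp [hff, hef, hfe, hξf, hfξ, hξe, hξξ, he, heξ]

/-- The smooth field `e` is of unit length and orthogonal to `ξ` near `p`. -/
structure UnitNear (e : VF 3 M) (p : M) : Prop where
  smooth : SmoothVF e
  unit : ∀ᶠ q in 𝓝 p, g.inner q (e q) (e q) = 1 ∧ g.inner q (e q) (S.ξ q) = 0

/-- A smooth field orthogonal to `ξ` can be normalized near any point where it does not vanish. -/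
theorem exists_unitNear_smul {v : VF 3 M} (hv : SmoothVF v)
    (hvξ : ∀ q, g.inner q (v q) (S.ξ q) = 0) {p : M} (hp : v p ≠ 0) :
    ∃ c : M → ℝ, S.UnitNear (c • v) p := by
  obtain ⟨ψ, hψ, hψ1⟩ := exists_contDiff_sq_mul_eq_one (g.pos p (v p) hp)
  have hs := smooth_inner g hv hv
  refine ⟨fun q => ψ (g.inner q (v q) (v q)), hv.smul (hψ.contMDiff.comp hs), ?_⟩
  filter_upwards [hs.continuous.continuousAt.eventually hψ1] with q hq
  constructor
  · rw [← hq]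
    simp [mul_assoc]
  · simp [hvξ]

theorem exists_unitNear [T2Space M] (p : M) : ∃ e : VF 3 M, S.UnitNear e p := by
  obtain ⟨v, hv⟩ : ∃ v : TangentSpace (𝓡 3) p, S.φ p v ≠ 0 := by
    -- If `φ` vanished at `p`, the formula for `φ²` would make `ξ` span the 3-dimensional tangent
    -- space.
    by_contra! h
    have hb : ∀ v : TangentSpace (𝓡 3) p, v ∈ Submodule.span ℝ {S.ξ p} := by
      intro v
      have := S.φ_sq p v
      rw [h, eq_comm, neg_add_eq_zero] at this
      rw [this]
      exact Submodule.smul_mem _ _ (Submodule.mem_span_singleton_self _)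
    have h1 : Module.finrank ℝ (EuclideanSpace ℝ (Fin 3)) ≤ 1 :=
      finrank_le_one (S.ξ p : EuclideanSpace ℝ (Fin 3)) fun w =>
        Submodule.mem_span_singleton.1 (hb w)
    simp at h1
  obtain ⟨X, hX, rfl⟩ := exists_smoothVF p v
  obtain ⟨c, hc⟩ := S.exists_unitNear_smul (S.smooth_φ X hX)
    (fun q => by rw [g.symm]; exact S.inner_ξ_φ q (X q)) hv
  exact ⟨_, hc⟩

theorem smooth_nabla [T2Space M] (S : ContactMetric g) (X Y : VF 3 M) (hX : SmoothVF X)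
    (hY : SmoothVF Y) : SmoothVF (nabla g X Y) := by
  refine smooth_nabla_of_frame (ι := Fin 3) (fun p => ?_) hX hY
  obtain ⟨e, he⟩ := S.exists_unitNear p
  refine ⟨![S.ξ, e, fun q => S.φ q (e q)], ?_, ?_⟩
  · intro i
    fin_cases i
    exacts [S.smooth_ξ, he.smooth, S.smooth_φ e he.smooth]
  · filter_upwards [he.unit] with q hq v
    rw [Fin.sum_univ_three]
    exact S.eq_frame_sum hq.1 hq.2 v

/-! ### The endomorphism `T = ∇ξ` -/

/-- The endomorphism `v ↦ ∇_v ξ`. -/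
def shape (p : M) : TangentSpace (𝓡 3) p →L[ℝ] TangentSpace (𝓡 3) p :=
  (exists_nabla_eq_linear g (S.smooth_ξ.diffVFAt p)).choose

theorem nabla_ξ {X : VF 3 M} {p : M} (hX : DiffVFAt X p) :
    nabla g X S.ξ p = S.shape p (X p) :=
  (exists_nabla_eq_linear g (S.smooth_ξ.diffVFAt p)).choose_spec X hX

theorem smooth_shape [T2Space M] {X : VF 3 M} (hX : SmoothVF X) :
    SmoothVF (fun q => S.shape q (X q)) := by
  rw [show (fun q => S.shape q (X q)) = nabla g X S.ξ from
    funext fun q => (S.nabla_ξ (hX.diffVFAt q)).symm]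
  exact S.smooth_nabla X _ hX S.smooth_ξ

theorem inner_shape_ξ (p : M) (v : TangentSpace (𝓡 3) p) :
    g.inner p (S.shape p v) (S.ξ p) = 0 := by
  obtain ⟨X, hX, rfl⟩ := exists_diffVFAt p v
  have hξ := S.smooth_ξ.diffVFAt p
  have h := nabla_metric (g := g) hX hξ hξ
  rw [dirDeriv_of_eventually_const (c := 1) (Eventually.of_forall S.inner_ξ_ξ),
    g.symm p (S.ξ p), S.nabla_ξ hX] at h
  linarith

/-- As `∇` is metric and torsion-free, the skew part of `∇ξ` is `dη`. In particular `T` vanishes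
nowhere. -/
theorem inner_shape_sub [T2Space M] (p : M) (v w : TangentSpace (𝓡 3) p) :
    g.inner p (S.shape p v) w - g.inner p (S.shape p w) v = 2 * g.inner p v (S.φ p w) := by
  obtain ⟨X, hX, rfl⟩ := exists_smoothVF p v
  obtain ⟨Y, hY, rfl⟩ := exists_smoothVF p w
  have hXp := hX.diffVFAt p
  have hYp := hY.diffVFAt p
  have hξ := S.smooth_ξ.diffVFAt p
  have h := S.extD_eq X Y hX hY p
  simp only [extD, S.η_eq] at h
  rw [nabla_metric hXp hYp hξ, nabla_metric hYp hXp hξ, ← nabla_torsion (g := g) hXp hYp,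
    map_sub, sub_apply, S.nabla_ξ hXp, S.nabla_ξ hYp, g.symm p (Y p),
    g.symm p (X p) (S.shape p _)] at h
  linarith

theorem shape_ξ [T2Space M] (p : M) : S.shape p (S.ξ p) = 0 := by
  refine eq_of_inner_eq (g := g) fun u => ?_
  have h := S.inner_shape_sub p (S.ξ p) u
  rw [S.inner_shape_ξ, S.inner_ξ_φ] at h
  simpa using h

namespace UnitNear

variable {S} {e : VF 3 M} {p : M}

theorem inner_self (he : S.UnitNear e p) : g.inner p (e p) (e p) = 1 := he.unit.self_of_nhds.1

theorem inner_ξ (he : S.UnitNear e p) : g.inner p (e p) (S.ξ p) = 0 := he.unit.self_of_nhds.2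

theorem eventually (he : S.UnitNear e p) : ∀ᶠ q in 𝓝 p, S.UnitNear e q :=
  he.unit.eventually_nhds.mono fun _ hq => ⟨he.smooth, hq⟩

theorem phi [T2Space M] (he : S.UnitNear e p) : S.UnitNear (fun q => S.φ q (e q)) p :=
  ⟨S.smooth_φ e he.smooth, he.unit.mono fun q hq =>
    ⟨by rw [S.inner_φ_φ, hq.1, hq.2]; ring, by rw [g.symm]; exact S.inner_ξ_φ q _⟩⟩

theorem inner_nabla_self (he : S.UnitNear e p) {X : VF 3 M} (hX : DiffVFAt X p) :
    g.inner p (nabla g X e p) (e p) = 0 := by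
  have h := nabla_metric (g := g) hX (he.smooth.diffVFAt p) (he.smooth.diffVFAt p)
  rw [dirDeriv_of_eventually_const (c := 1) (he.unit.mono fun q hq => hq.1),
    g.symm p (e p)] at h
  linarith

theorem inner_nabla_ξ (he : S.UnitNear e p) {X : VF 3 M} (hX : DiffVFAt X p) :
    g.inner p (nabla g X e p) (S.ξ p) = - g.inner p (S.shape p (X p)) (e p) := by
  have h := nabla_metric (g := g) hX (he.smooth.diffVFAt p) (S.smooth_ξ.diffVFAt p)
  rw [dirDeriv_of_eventually_const (c := 0) (he.unit.mono fun q hq => hq.2),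
    g.symm p (e p), S.nabla_ξ hX] at h
  linarith

theorem inner_nabla_phi [T2Space M] (he : S.UnitNear e p) {X : VF 3 M} (hX : DiffVFAt X p) :
    g.inner p (nabla g X (fun q => S.φ q (e q)) p) (e p) =
      - g.inner p (nabla g X e p) (S.φ p (e p)) := by
  have h := nabla_metric (g := g) hX (he.smooth.diffVFAt p) (he.phi.smooth.diffVFAt p)
  rw [dirDeriv_of_eventually_const (c := 0)
    (Eventually.of_forall fun q => S.inner_self_φ q (e q)), g.symm p (e p)] at h
  linarith

theorem eq_of_inner [T2Space M] (he : S.UnitNear e p) {v w : TangentSpace (𝓡 3) p}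
    (h₀ : g.inner p v (S.ξ p) = g.inner p w (S.ξ p))
    (h₁ : g.inner p v (e p) = g.inner p w (e p))
    (h₂ : g.inner p v (S.φ p (e p)) = g.inner p w (S.φ p (e p))) : v = w := by
  rw [S.eq_frame_sum he.inner_self he.inner_ξ v, S.eq_frame_sum he.inner_self he.inner_ξ w,
    h₀, h₁, h₂]

end UnitNear

/-! ### Flatness when `R(X, Y)ξ = 0` -/

/-- The Codazzi equation for the endomorphism `∇ξ` when `R(X, Y)ξ = 0`. -/
theorem codazzi
    (hR : ∀ X Y : VF 3 M, SmoothVF X → SmoothVF Y → ∀ p, curv g X Y S.ξ p = 0)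
    {X Y : VF 3 M} (hX : SmoothVF X) (hY : SmoothVF Y) (p : M) :
    nabla g X (fun q => S.shape q (Y q)) p - nabla g Y (fun q => S.shape q (X q)) p =
      S.shape p (bracket X Y p) := by
  have e : ∀ {Z : VF 3 M}, SmoothVF Z → (fun q => S.shape q (Z q)) = nabla g Z S.ξ :=
    fun hZ => funext fun q => (S.nabla_ξ (hZ.diffVFAt q)).symm
  rw [e hX, e hY, ← S.nabla_ξ ((hX.bracket hY).diffVFAt p), ← sub_eq_zero]
  exact hR X Y hX hY p

/-- The Riccati equation `∇_ξ T = -T²` for the endomorphism `T = ∇ξ` when `R(X, Y)ξ = 0`. -/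
theorem riccati [T2Space M]
    (hR : ∀ X Y : VF 3 M, SmoothVF X → SmoothVF Y → ∀ p, curv g X Y S.ξ p = 0)
    {A B : VF 3 M} (hA : SmoothVF A) (hB : SmoothVF B) (p : M) :
    dirDeriv S.ξ (fun q => g.inner q (S.shape q (A q)) (B q)) p =
      g.inner p (S.shape p (A p)) (nabla g S.ξ B p)
      - g.inner p (S.shape p (S.shape p (A p))) (B p)
      + g.inner p (S.shape p (nabla g S.ξ A p)) (B p) := by
  have hξ := S.smooth_ξ.diffVFAt p
  -- Since `Tξ = 0`, Codazzi for `ξ, A` reads `∇_ξ(TA) = T[ξ, A] = T(∇_ξ A) - T²A`.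
  have c := S.codazzi hR S.smooth_ξ hA p
  rw [nabla_of_eventually_eq_zero (hA.diffVFAt p) ((S.smooth_shape S.smooth_ξ).diffVFAt p)
    (Eventually.of_forall fun q => S.shape_ξ q), sub_zero,
    ← nabla_torsion (g := g) hξ (hA.diffVFAt p), S.nabla_ξ (hA.diffVFAt p)] at c
  rw [nabla_metric hξ ((S.smooth_shape hA).diffVFAt p) (hB.diffVFAt p), c]
  simp only [map_sub, sub_apply]
  ring

/-- These are the skew part and the trace of `∇_ξ T = -T²` on `ξ^⊥`. The skew part of `T²` is `tr T`
times that of `T`, whereas the skew part of `T` has constant matrix, so `tr T = 0`. -/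
theorem frame_riccati [T2Space M]
    (hR : ∀ X Y : VF 3 M, SmoothVF X → SmoothVF Y → ∀ p, curv g X Y S.ξ p = 0)
    {e : VF 3 M} {p : M} (he : S.UnitNear e p) :
    g.inner p (S.shape p (e p)) (e p)
      + g.inner p (S.shape p (S.φ p (e p))) (S.φ p (e p)) = 0 ∧
    dirDeriv S.ξ (fun q => g.inner q (S.shape q (e q)) (e q)) p
      + dirDeriv S.ξ (fun q => g.inner q (S.shape q (S.φ q (e q))) (S.φ q (e q))) p =
      - (g.inner p (S.shape p (e p)) (e p) ^ 2
        + 2 * (g.inner p (S.shape p (e p)) (S.φ p (e p))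
          * g.inner p (S.shape p (S.φ p (e p))) (e p))
        + g.inner p (S.shape p (S.φ p (e p))) (S.φ p (e p)) ^ 2) := by
  have hf := he.phi
  have hξ := S.smooth_ξ.diffVFAt p
  have hee := he.inner_self
  have hff : g.inner p (S.φ p (e p)) (S.φ p (e p)) = 1 := hf.inner_self
  have hef := S.inner_self_φ p (e p)
  have hfe : g.inner p (S.φ p (e p)) (e p) = 0 := by rw [g.symm]; exact hef
  have Te := S.eq_frame_sum hee he.inner_ξ (S.shape p (e p))
  have Tf := S.eq_frame_sum hee he.inner_ξ (S.shape p (S.φ p (e p)))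
  have Ne := S.eq_frame_sum hee he.inner_ξ (nabla g S.ξ e p)
  have Nf := S.eq_frame_sum hee he.inner_ξ (nabla g S.ξ (fun q => S.φ q (e q)) p)
  have nf : g.inner p (nabla g S.ξ (fun q => S.φ q (e q)) p) (S.φ p (e p)) = 0 :=
    hf.inner_nabla_self hξ
  have nfξ : g.inner p (nabla g S.ξ (fun q => S.φ q (e q)) p) (S.ξ p) = 0 := by
    rw [hf.inner_nabla_ξ hξ, S.shape_ξ]; simp
  rw [S.inner_shape_ξ, zero_smul, zero_add] at Te Tf
  rw [he.inner_nabla_ξ hξ, he.inner_nabla_self hξ, S.shape_ξ] at Ne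
  rw [nf, nfξ, he.inner_nabla_phi hξ] at Nf
  have r11 := S.riccati hR he.smooth he.smooth p
  have r12 := S.riccati hR he.smooth hf.smooth p
  have r21 := S.riccati hR hf.smooth he.smooth p
  have r22 := S.riccati hR hf.smooth hf.smooth p
  have hd : dirDeriv S.ξ (fun q => g.inner q (S.shape q (e q)) (S.φ q (e q))) p
      - dirDeriv S.ξ (fun q => g.inner q (S.shape q (S.φ q (e q))) (e q)) p = 0 := by
    rw [← dirDeriv_of_eventually_const (X := S.ξ) (p := p) (c := -2)
      (f := fun q => g.inner q (S.shape q (e q)) (S.φ q (e q))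
        - g.inner q (S.shape q (S.φ q (e q))) (e q))]
    · simp only [dirDeriv]
      rw [mvfderiv_fun_sub
        (diff_inner g ((S.smooth_shape he.smooth).diffVFAt p) (hf.smooth.diffVFAt p))
        (diff_inner g ((S.smooth_shape hf.smooth).diffVFAt p) (he.smooth.diffVFAt p))]
      rfl
    · filter_upwards [he.unit] with q hq
      rw [S.inner_shape_sub, S.inner_φ_skew, S.inner_φ_φ, hq.1, hq.2]
      norm_num
  have hs := S.inner_shape_sub p (e p) (S.φ p (e p))
  rw [S.inner_φ_skew p (e p) (S.φ p _), hff] at hs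
  -- `a, b, c, d` are the matrix entries of `T` on `ξ^⊥`, with `b - c = -2`. The rotation `m` of the
  -- frame along `ξ` cancels from both combinations below.
  generalize g.inner p (S.shape p (e p)) (e p) = a at *
  generalize g.inner p (S.shape p (e p)) (S.φ p (e p)) = b at *
  generalize g.inner p (S.shape p (S.φ p (e p))) (e p) = c at *
  generalize g.inner p (S.shape p (S.φ p (e p))) (S.φ p (e p)) = d at *
  generalize g.inner p (nabla g S.ξ e p) (S.φ p (e p)) = m at *
  simp only [Te, Tf, Ne, Nf, map_add, map_smul, add_apply, smul_apply, map_zero,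
    zero_apply, neg_zero, zero_smul, zero_add, add_zero, smul_eq_mul, hee, hff, hef, hfe, mul_zero,
    mul_one] at r11 r12 r21 r22
  constructor
  · linear_combination (-1 / 2 : ℝ) * (r12 - r21) + (1 / 2 : ℝ) * hd + (a + d) / 2 * hs
  · linear_combination r11 + r22

/-- The trace vanishes near `p`, so its `ξ`-derivative is zero and `tr T² = 2(a² + bc) = 0`. A
trace-free 2×2 matrix with zero determinant squares to zero. -/
theorem shape_shape [T2Space M]
    (hR : ∀ X Y : VF 3 M, SmoothVF X → SmoothVF Y → ∀ p, curv g X Y S.ξ p = 0)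
    (p : M) (v : TangentSpace (𝓡 3) p) : S.shape p (S.shape p v) = 0 := by
  obtain ⟨e, he⟩ := S.exists_unitNear p
  have hf := he.phi
  have hee := he.inner_self
  have htr := (S.frame_riccati hR he).1
  have hdet : g.inner p (S.shape p (e p)) (e p) ^ 2
      + g.inner p (S.shape p (e p)) (S.φ p (e p))
        * g.inner p (S.shape p (S.φ p (e p))) (e p) = 0 := by
    have h2 := (S.frame_riccati hR he).2
    have hd : dirDeriv S.ξ (fun q => g.inner q (S.shape q (e q)) (e q)) p
        + dirDeriv S.ξ (fun q => g.inner q (S.shape q (S.φ q (e q))) (S.φ q (e q))) p = 0 := by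
      rw [← dirDeriv_of_eventually_const (X := S.ξ)
        (he.eventually.mono fun q hq => (S.frame_riccati hR hq).1)]
      simp only [dirDeriv]
      rw [mvfderiv_fun_add
        (diff_inner g ((S.smooth_shape he.smooth).diffVFAt p) (he.smooth.diffVFAt p))
        (diff_inner g ((S.smooth_shape hf.smooth).diffVFAt p) (hf.smooth.diffVFAt p))]
      rfl
    rw [hd] at h2
    rw [eq_neg_of_add_eq_zero_right htr] at h2
    linarith
  have Te := S.eq_frame_sum hee he.inner_ξ (S.shape p (e p))
  have Tf := S.eq_frame_sum hee he.inner_ξ (S.shape p (S.φ p (e p)))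
  rw [S.inner_shape_ξ, zero_smul, zero_add] at Te Tf
  generalize g.inner p (S.shape p (e p)) (e p) = a at *
  generalize g.inner p (S.shape p (e p)) (S.φ p (e p)) = b at *
  generalize g.inner p (S.shape p (S.φ p (e p))) (e p) = c at *
  generalize g.inner p (S.shape p (S.φ p (e p))) (S.φ p (e p)) = d at *
  have hTTe : S.shape p (S.shape p (e p)) = 0 := by
    rw [Te, map_add, map_smul, map_smul, Te, Tf]
    calc a • (a • e p + b • S.φ p (e p)) + b • (c • e p + d • S.φ p (e p))
        = (a ^ 2 + b * c) • e p + (b * (a + d)) • S.φ p (e p) := by module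
      _ = 0 := by rw [hdet, htr]; simp
  have hTTf : S.shape p (S.shape p (S.φ p (e p))) = 0 := by
    rw [Tf, map_add, map_smul, map_smul, Te, Tf]
    calc c • (a • e p + b • S.φ p (e p)) + d • (c • e p + d • S.φ p (e p))
        = (c * (a + d)) • e p
          + (a ^ 2 + b * c + (a + d) * (d - a)) • S.φ p (e p) := by module
      _ = 0 := by rw [hdet, htr]; simp
  rw [S.eq_frame_sum hee he.inner_ξ v]
  simp [map_add, map_smul, S.shape_ξ, hTTe, hTTf]

/-- If `R(X, Y)ξ = 0`, then near any point there is a unit field `e` orthogonal to `ξ` with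
`∇_e ξ = -2 φ e` and `∇_{φ e} ξ = 0`. -/
theorem exists_adapted_frame [T2Space M]
    (hR : ∀ X Y : VF 3 M, SmoothVF X → SmoothVF Y → ∀ p, curv g X Y S.ξ p = 0)
    (p : M) : ∃ e : VF 3 M, S.UnitNear e p ∧
    ∀ᶠ q in 𝓝 p, S.shape q (e q) = (-2 : ℝ) • S.φ q (e q) ∧ S.shape q (S.φ q (e q)) = 0 := by
  obtain ⟨v, hv⟩ : ∃ v : TangentSpace (𝓡 3) p, S.shape p v ≠ 0 := by
    by_contra! h
    obtain ⟨e, he⟩ := S.exists_unitNear p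
    have hs := S.inner_shape_sub p (S.φ p (e p)) (e p)
    have hff : g.inner p (S.φ p (e p)) (S.φ p (e p)) = 1 := he.phi.inner_self
    simp [h, hff] at hs
  obtain ⟨X, hX, rfl⟩ := exists_smoothVF p v
  -- The unit field `f` is taken in the image of `T`, hence `Tf = 0` by `T² = 0`; then `e = -φf`
  -- satisfies `φe = f`.
  obtain ⟨c, hc⟩ := S.exists_unitNear_smul (S.smooth_shape hX)
    (fun q => S.inner_shape_ξ q (X q)) hv
  have hTf : ∀ q, S.shape q ((c • fun q => S.shape q (X q)) q) = 0 := fun q => by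
    rw [Pi.smul_apply', map_smul, S.shape_shape hR, smul_zero]
  generalize (c • fun q => S.shape q (X q)) = f at *
  have hφe : ∀ᶠ q in 𝓝 p, S.φ q ((-fun q => S.φ q (f q)) q) = f q := by
    filter_upwards [hc.unit] with q hq
    rw [Pi.neg_apply, map_neg, S.φ_sq, S.η_eq, hq.2]
    simp
  have he : S.UnitNear (-fun q => S.φ q (f q)) p :=
    ⟨hc.phi.smooth.neg, hc.phi.unit.mono fun q hq => by simpa using hq⟩
  refine ⟨_, he, ?_⟩
  filter_upwards [hφe, he.eventually] with q hq heq
  rw [hq]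
  refine ⟨?_, hTf q⟩
  have htr := (S.frame_riccati hR heq).1
  have hs := S.inner_shape_sub q ((-fun q => S.φ q (f q)) q) (f q)
  have hff := heq.phi.inner_self
  have hef := S.inner_self_φ q ((-fun q => S.φ q (f q)) q)
  have hfξ := heq.phi.inner_ξ
  have hskew := S.inner_φ_skew q ((-fun q => S.φ q (f q)) q) (f q)
  simp only [hq] at htr hff hef hskew hfξ
  simp only [hTf, map_zero, zero_apply, add_zero, sub_zero, hskew, hff] at htr hs
  -- The `e`-component of `Te` vanishes because `tr T = 0`; the skew part of `T` forces the
  -- `φe`-component to be `-2`.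
  refine heq.eq_of_inner ?_ ?_ ?_
  · rw [S.inner_shape_ξ, map_smul, smul_apply, hfξ, smul_zero]
  · rw [htr, map_smul, smul_apply, g.symm, hef, smul_zero]
  · rw [hq, hs, map_smul, smul_apply, hff]
    norm_num

/-- The field `e` of an adapted frame is parallel. -/
theorem nabla_adapted_eq_zero [T2Space M]
    (hR : ∀ X Y : VF 3 M, SmoothVF X → SmoothVF Y → ∀ p, curv g X Y S.ξ p = 0)
    {e : VF 3 M} {p : M} (he : S.UnitNear e p)
    (h : ∀ᶠ q in 𝓝 p, S.shape q (e q) = (-2 : ℝ) • S.φ q (e q) ∧ S.shape q (S.φ q (e q)) = 0)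
    {X : VF 3 M} (hX : DiffVFAt X p) : nabla g X e p = 0 := by
  have hf := he.phi
  have hξ := S.smooth_ξ.diffVFAt p
  have hep := he.smooth.diffVFAt p
  have hfp := hf.smooth.diffVFAt p
  have hTep := (S.smooth_shape he.smooth).diffVFAt p
  have hTfp := (S.smooth_shape hf.smooth).diffVFAt p
  have hee := he.inner_self
  have hff : g.inner p (S.φ p (e p)) (S.φ p (e p)) = 1 := hf.inner_self
  have hef := S.inner_self_φ p (e p)
  have hfe : g.inner p (S.φ p (e p)) (e p) = 0 := by rw [g.symm]; exact hef
  obtain ⟨hTe, hTf⟩ := h.self_of_nhds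
  have hT : ∀ v, S.shape p v = (-2 * g.inner p v (e p)) • S.φ p (e p) := fun v => by
    conv_lhs => rw [S.eq_frame_sum hee he.inner_ξ v]
    simp [map_add, map_smul, S.shape_ξ, hTe, hTf, smul_smul, mul_comm]
  obtain ⟨L, hL⟩ := exists_nabla_eq_linear g hep
  -- Only the coefficient `ω(A) = g(∇_A e, φe)` of `∇_A e` is not immediately zero. `m1` and `m2`
  -- are the components of `∇_A(Te) = -2∇_A(φe)`.
  have m1 : ∀ {A : VF 3 M}, DiffVFAt A p →
      g.inner p (nabla g A (fun q => S.shape q (e q)) p) (e p)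
        = 2 * g.inner p (nabla g A e p) (S.φ p (e p)) := fun {A} hA => by
    have := nabla_metric (g := g) hA hTep hep
    rw [dirDeriv_of_eventually_const (c := 0) (h.mono fun q hq => by
      rw [hq.1, map_smul, smul_apply, g.symm, S.inner_self_φ, smul_zero]), hTe, map_smul,
      smul_apply, g.symm p (S.φ p _), smul_eq_mul] at this
    linarith
  have m2 : ∀ {A : VF 3 M}, DiffVFAt A p →
      g.inner p (nabla g A (fun q => S.shape q (e q)) p) (S.φ p (e p)) = 0 := fun {A} hA => by
    have := nabla_metric (g := g) hA hTep hfp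
    rw [dirDeriv_of_eventually_const (c := -2) ((h.and hf.unit).mono fun q hq => by
      rw [hq.1.1, map_smul, smul_apply, hq.2.1]; norm_num), hTe, map_smul, smul_apply,
      g.symm p (S.φ p _), hf.inner_nabla_self hA, smul_zero, add_zero] at this
    exact this.symm
  have hξe : g.inner p (L (S.ξ p)) (S.φ p (e p)) = 0 := by
    have c := S.codazzi hR S.smooth_ξ he.smooth p
    rw [nabla_of_eventually_eq_zero hep ((S.smooth_shape S.smooth_ξ).diffVFAt p)
      (Eventually.of_forall fun q => S.shape_ξ q), sub_zero, hT] at c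
    have := m1 hξ
    rw [c, map_smul, smul_apply, hfe, smul_zero, hL _ hξ] at this
    linarith
  -- Here `∇_{φe}(Te) = T[φe, e]` is a multiple of `φe`. Its `e`-component gives `ω(φe) = 0`, and
  -- its `φe`-component gives `g([φe, e], e) = ω(e) = 0`.
  have cf := S.codazzi hR hf.smooth he.smooth p
  rw [nabla_of_eventually_eq_zero hep hTfp (h.mono fun q hq => hq.2), sub_zero, hT,
    ← nabla_torsion (g := g) hfp hep] at cf
  have hfe' : g.inner p (L (S.φ p (e p))) (S.φ p (e p)) = 0 := by
    have := m1 hfp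
    rw [cf, map_smul, smul_apply, hfe, smul_zero, hL _ hfp] at this
    linarith
  have hee' : g.inner p (L (e p)) (S.φ p (e p)) = 0 := by
    have := m2 hfp
    rw [cf, map_smul, smul_apply, hff, map_sub, sub_apply, he.inner_nabla_self hfp,
      he.inner_nabla_phi hep, hL _ hep, smul_eq_mul] at this
    linarith
  refine he.eq_of_inner ?_ ?_ ?_
  · rw [he.inner_nabla_ξ hX, hT, map_smul, smul_apply, hfe]
    simp
  · rw [he.inner_nabla_self hX]
    simp
  · rw [hL X hX, S.eq_frame_sum hee he.inner_ξ (X p)]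
    simp [map_add, map_smul, hξe, hfe', hee']

/-- A 3-dimensional contact metric manifold with `R(X, Y)ξ = 0` is flat. -/
theorem isFlat_of_curv_ξ [T2Space M]
    (hR : ∀ X Y : VF 3 M, SmoothVF X → SmoothVF Y → ∀ p, curv g X Y S.ξ p = 0) : IsFlat g := by
  intro X Y Z hX hY hZ p
  obtain ⟨e, he, h⟩ := S.exists_adapted_frame hR p
  have hN : ∀ X Y : VF 3 M, SmoothVF X → SmoothVF Y → SmoothVF (nabla g X Y) := S.smooth_nabla
  have hpar : ∀ {A : VF 3 M}, SmoothVF A → ∀ᶠ q in 𝓝 p, nabla g A e q = 0 := fun hA => by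
    filter_upwards [he.eventually, h.eventually_nhds] with q hq hq'
    exact S.nabla_adapted_eq_zero hR hq hq' (hA.diffVFAt q)
  have hRe : ∀ {A B : VF 3 M}, SmoothVF A → SmoothVF B → curv g A B e p = 0 := fun {A B} hA hB => by
    simp only [curv, Pi.sub_apply]
    rw [nabla_of_eventually_eq_zero (hA.diffVFAt p) ((hN B e hB he.smooth).diffVFAt p) (hpar hB),
      nabla_of_eventually_eq_zero (hB.diffVFAt p) ((hN A e hA he.smooth).diffVFAt p) (hpar hA),
      (hpar (hA.bracket hB)).self_of_nhds]
    simp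
  have h0 : ∀ {W : VF 3 M}, SmoothVF W → g.inner p (curv g X Y W p) (S.ξ p) = 0 := fun hW => by
    rw [inner_curv_skew hN hX hY hW S.smooth_ξ, hR X Y hX hY]
    simp
  have h1 : ∀ {W : VF 3 M}, SmoothVF W → g.inner p (curv g X Y W p) (e p) = 0 := fun hW => by
    rw [inner_curv_skew hN hX hY hW he.smooth, hRe hX hY]
    simp
  have hf := he.phi.smooth
  -- By skewness the image of `R(X, Y)` lies along `φe`, and `g(R(X, Y)φe, φe) = 0`.
  have hRf : curv g X Y (fun q => S.φ q (e q)) p = 0 := by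
    refine he.eq_of_inner ?_ ?_ ?_
    · rw [h0 hf]; simp
    · rw [h1 hf]; simp
    · have := inner_curv_skew hN hX hY hf hf p
      simp only [map_zero, zero_apply]
      linarith
  refine he.eq_of_inner ?_ ?_ ?_
  · rw [h0 hZ]; simp
  · rw [h1 hZ]; simp
  · have := inner_curv_skew hN hX hY hZ hf p
    rw [hRf] at this
    simpa using this

/-! ### Vanishing of `k` and the conclusion -/

/-- The nullity constant of a `φ`-recurrent structure vanishes. -/
theorem nullity_const_eq_zero [T2Space M] {k : ℝ} (hk : S.IsNk k) (hrec : S.IsPhiRecurrent) :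
    k = 0 := by
  obtain ⟨A, -, ⟨p, hp⟩, hA⟩ := hrec
  obtain ⟨w, hw⟩ : ∃ w, A p w ≠ 0 := by
    by_contra! h
    exact hp (ContinuousLinearMap.ext h)
  obtain ⟨W, hW, rfl⟩ := exists_smoothVF p w
  obtain ⟨e, he⟩ := S.exists_unitNear p
  -- The left side becomes 0 and the right side `A(W) g(R(e, ξ)e, ξ) = -A(W) g(R(e, ξ)ξ, e) = -k
  -- A(W)`.
  have h := congrArg (g.inner p (S.ξ p)) (hA W e S.ξ e hW he.smooth S.smooth_ξ he.smooth p)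
  rw [S.inner_ξ_φ, map_smul, smul_eq_mul, g.symm,
    inner_curv_skew S.smooth_nabla he.smooth S.smooth_ξ he.smooth S.smooth_ξ,
    hk p e S.ξ S.ξ he.smooth S.smooth_ξ S.smooth_ξ rfl, S.inner_ξ_ξ, he.inner_ξ] at h
  simpa [he.inner_self, hw] using h

end ContactMetric

end Contact

end ContactGeom

end

theorem theorem3p7 {M : Type*} [TopologicalSpace M] [T2Space M]
    [ChartedSpace (EuclideanSpace ℝ (Fin 3)) M] [IsManifold (𝓡 3) ∞ M]
    (g : ContactGeom.RMetric 3 M) (S : ContactGeom.ContactMetric g) (k : ℝ)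
    (hk : S.IsNk k) (hrec : S.IsPhiRecurrent) :
    ContactGeom.IsFlat g ∧ ContactGeom.IsSymmetricMetric g ∧ S.IsLocallyPhiSymmetric := by
  obtain rfl := S.nullity_const_eq_zero hk hrec
  have hflat : ContactGeom.IsFlat g := S.isFlat_of_curv_ξ fun X Y hX hY p => by
    rw [hk p X Y S.ξ hX hY S.smooth_ξ rfl, zero_smul]
  have hsym : ContactGeom.IsSymmetricMetric g := by
    intro W X Y Z hW hX hY hZ p
    have h0 : ContactGeom.curv g X Y Z = 0 := funext fun q => hflat X Y Z hX hY hZ q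
    simp only [ContactGeom.nablaCurv, Pi.sub_apply]
    rw [hflat _ Y Z (S.smooth_nabla W X hW hX) hY hZ, hflat X _ Z hX (S.smooth_nabla W Y hW hY) hZ,
      hflat X Y _ hX hY (S.smooth_nabla W Z hW hZ), h0,
      ContactGeom.nabla_of_eventually_eq_zero (hW.diffVFAt p)
        (ContactGeom.SmoothVF.zero.diffVFAt p) (Filter.Eventually.of_forall fun _ => rfl)]
    simp
  refine ⟨hflat, hsym, fun W X Y Z hW hX hY hZ _ _ _ _ p => ?_⟩
  rw [hsym W X Y Z hW hX hY hZ, map_zero, map_zero]
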